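/- Let $\mathbb H$ be the upper half-plane with its hyperbolic metric, on which $G=\mathrm{PSL}_2(\mathbb R)$ acts by Möbius transformations, and let $\sigma(z)=-\overline z$. Let $\Gamma$ be a discrete, torsion-free subgroup of $G$ such that the quotient $\mathbb X=\Gamma\backslash\mathbb H$ is compact and $\sigma\Gamma\sigma=\Gamma$. Then $\sigma^*(\Gamma z)=\Gamma\sigma(z)$ is a well-defined involution of $\mathbb X$, and every connected component of its fixed point set $\mathrm{Fix}(\sigma^*,\mathbb X)=\{x\in\mathbb X:\sigma^*(x)=x\}$ is a closed geodesic in $\mathbb X$; that is, it is the image of a unit speed geodesic $\mathbb R\to\mathbb X$ (the projection to $\mathbb X$ of a complete unit speed geodesic of $\mathbb H$) which is periodic with some period $L>0$. -/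

import Mathlib

open scoped MatrixGroups ComplexConjugate UpperHalfPlane

noncomputable section

namespace HypSurface

theorem smul_eq_of_mem_center (g : SL(2, ℝ)) (hg : g ∈ Subgroup.center SL(2, ℝ)) (z : ℍ) :
    g • z = z := by
  obtain ⟨r, hr, h⟩ := (Matrix.SpecialLinearGroup.mem_center_iff).1 hg
  have hr0 : r ≠ 0 := by
    rintro rfl
    simp at hr
  have h2 : ∀ i j, g i j = Matrix.scalar (Fin 2) r i j := fun i j => by rw [h]
  ext1
  rw [UpperHalfPlane.coe_specialLinearGroup_apply]
  simp [h2, hr0]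

/-- The action of `PSL(2, ℝ) = SL(2, ℝ) / {±1}` on the upper half-plane by Möbius
transformations, induced by the one of `SL(2, ℝ)`. -/
instance pslAction : MulAction PSL(2, ℝ) ℍ where
  smul g z := Quotient.liftOn' g (fun a : SL(2, ℝ) => a • z) (by
    intro a b hab
    have h := smul_eq_of_mem_center _ (QuotientGroup.leftRel_apply.1 hab) z
    change a • z = b • z
    rw [mul_smul, inv_smul_eq_iff] at h
    exact h.symm)
  one_smul z := one_smul SL(2, ℝ) z
  mul_smul g h z := by
    induction g using QuotientGroup.induction_on
    induction h using QuotientGroup.induction_on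
    exact mul_smul (α := SL(2, ℝ)) _ _ z

/-- The orientation reversing isometry `σ(z) = -z̄` of the upper half-plane. -/
def sigma (z : ℍ) : ℍ := ⟨-conj (z : ℂ), by simpa using z.im_pos⟩

/-- The map `(a, b; c, d) ↦ (a, -b; -c, d)` on `SL(2, ℝ)`. -/
def hatFun (g : SL(2, ℝ)) : SL(2, ℝ) :=
  ⟨!![g 0 0, -g 0 1; -g 1 0, g 1 1], by
    have h := g.det_coe
    rw [Matrix.det_fin_two] at h
    simp [Matrix.det_fin_two, h]⟩

theorem hatFun_coe (g : SL(2, ℝ)) :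
    (hatFun g : Matrix (Fin 2) (Fin 2) ℝ) = !![g 0 0, -g 0 1; -g 1 0, g 1 1] := rfl

/-- The automorphism `(a, b; c, d) ↦ (a, -b; -c, d)` of `SL(2, ℝ)`. -/
def hatSL : SL(2, ℝ) →* SL(2, ℝ) where
  toFun := hatFun
  map_one' := by
    ext i j
    fin_cases i <;> fin_cases j <;> simp [hatFun_coe]
  map_mul' g h := by
    ext i j
    fin_cases i <;> fin_cases j <;>
      simp [hatFun_coe, Matrix.mul_apply, Fin.sum_univ_two, add_comm]

theorem hatSL_coe (g : SL(2, ℝ)) :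
    (hatSL g : Matrix (Fin 2) (Fin 2) ℝ) = !![g 0 0, -g 0 1; -g 1 0, g 1 1] := rfl

theorem hatSL_mem_center (g : SL(2, ℝ)) (hg : g ∈ Subgroup.center SL(2, ℝ)) :
    hatSL g ∈ Subgroup.center SL(2, ℝ) := by
  obtain ⟨r, hr, h⟩ := (Matrix.SpecialLinearGroup.mem_center_iff).1 hg
  refine (Matrix.SpecialLinearGroup.mem_center_iff).2 ⟨r, hr, ?_⟩
  have h2 : ∀ i j, g i j = Matrix.scalar (Fin 2) r i j := fun i j => by rw [h]
  ext i j
  fin_cases i <;> fin_cases j <;> simp [hatSL_coe, h2]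

/-- The automorphism `α ↦ α̂ = σ α σ` of `PSL(2, ℝ)`, given on matrices by
`(a, b; c, d) ↦ (a, -b; -c, d)`; see `hat_smul`. -/
def hat : PSL(2, ℝ) →* PSL(2, ℝ) :=
  QuotientGroup.map _ _ hatSL hatSL_mem_center

/-- `hat g` is the transformation `σ g σ` of the upper half-plane. -/
theorem hat_smul (g : PSL(2, ℝ)) (z : ℍ) : hat g • z = sigma (g • sigma z) := by
  induction g using QuotientGroup.induction_on with
  | H a =>
    change hatSL a • z = sigma (a • sigma z)
    ext1
    simp only [sigma, UpperHalfPlane.coe_specialLinearGroup_apply, hatSL_coe]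
    simp
    rw [← neg_div]
    congr 1; ring

theorem sigma_sigma (z : ℍ) : sigma (sigma z) = z := by
  ext1
  simp [sigma]

/-- The surface `X = Γ \ ℍ`, a topological space with the quotient topology. -/
abbrev Surface (Γ : Subgroup PSL(2, ℝ)) : Type := MulAction.orbitRel.Quotient Γ ℍ

/-- The projection `z ↦ Γ z` from `ℍ` to `Γ \ ℍ`. -/
def proj (Γ : Subgroup PSL(2, ℝ)) (z : ℍ) : Surface Γ := Quotient.mk _ z

/-- The involution `σ*(Γ z) = Γ σ(z)` of `Γ \ ℍ`, where `σ Γ σ = Γ`. -/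
def sigmaStar (Γ : Subgroup PSL(2, ℝ)) (hΓ : Γ.map hat = Γ) : Surface Γ → Surface Γ :=
  Quotient.map sigma (by
    rintro z w ⟨g, rfl⟩
    have hg : hat g ∈ Γ := by
      have h := Subgroup.mem_map_of_mem hat g.2
      rwa [hΓ] at h
    refine ⟨⟨hat g, hg⟩, ?_⟩
    change hat (g : PSL(2, ℝ)) • sigma w = sigma ((g : PSL(2, ℝ)) • w)
    rw [hat_smul, sigma_sigma])

/-- A subset `C` of `Γ \ ℍ` is a closed geodesic if it is the image of a periodic geodesic of
positive period. The unit speed geodesics `ℝ → Γ \ ℍ` are the projections of the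
complete unit speed geodesics of `ℍ`, that is, of the isometric embeddings `c : ℝ → ℍ` for the
hyperbolic distance. -/
def IsClosedGeodesic (Γ : Subgroup PSL(2, ℝ)) (C : Set (Surface Γ)) : Prop :=
  ∃ (c : ℝ → ℍ) (L : ℝ), Isometry c ∧ 0 < L ∧
    Function.Periodic (fun t => proj Γ (c t)) L ∧ C = Set.range (fun t => proj Γ (c t))

end HypSurface

end

/-!
A point `Γ z` is fixed by `σ*` exactly when `g z = σ z` for some `g ∈ Γ`, so the fixed point set is
the image of the union of the mirrors `{z | g z = σ z}`, `g ∈ Γ`. A nonempty mirror is a complete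
geodesic, because `σ g` is then conjugate to `σ`. Since `Γ` acts properly discontinuously, the
mirrors form a locally finite family, and since it acts freely they are pairwise disjoint. Hence the
`Γ`-orbit of a mirror is relatively clopen in the union, and the components of the fixed point set
are the images of the single mirrors. By cocompactness the stabilizer of a mirror acts cocompactly
on it, so it contains a nontrivial element, which can only be a translation along the mirror.
-/

open Set MulAction
open scoped Pointwise

section Topology

variable {X Y : Type*} [TopologicalSpace X] [TopologicalSpace Y]

theorem connectedComponentIn_union_eq_left {s t : Set X} (hs : IsClosed s) (ht : IsClosed t)
    (hst : Disjoint s t) (hconn : IsPreconnected s) {x : X} (hx : x ∈ s) :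
    connectedComponentIn (s ∪ t) x = s := by
  have hsub := hconn.subset_connectedComponentIn hx (subset_union_left (t := t))
  refine Subset.antisymm ?_ hsub
  refine (isPreconnected_iff_subset_of_disjoint_closed.1 isPreconnected_connectedComponentIn s t
    hs ht (connectedComponentIn_subset _ _) ?_).resolve_right fun h => ?_
  · rw [hst.inter_eq, inter_empty]
  · exact disjoint_left.1 hst hx (h (hsub hx))

theorem exists_isCompact_image_eq_univ [WeaklyLocallyCompactSpace X] [CompactSpace Y] {f : X → Y}
    (hf : IsOpenQuotientMap f) : ∃ K, IsCompact K ∧ f '' K = univ := by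
  choose K hK hKx using fun x : X => exists_compact_mem_nhds x
  choose s hs using hf.surjective
  obtain ⟨T, hT⟩ := finite_cover_nhds fun y => hs y ▸ hf.isOpenMap.image_mem_nhds (hKx (s y))
  refine ⟨⋃ y ∈ T, K (s y), T.isCompact_biUnion fun y _ => hK (s y), ?_⟩
  simpa only [image_iUnion₂] using hT

theorem isClosed_sUnion_of_locallyFinite {𝒞 : Set (Set X)}
    (hlf : LocallyFinite ((↑) : 𝒞 → Set X)) (hclosed : ∀ C ∈ 𝒞, IsClosed C) :
    IsClosed (⋃₀ 𝒞) := by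
  rw [sUnion_eq_iUnion]
  exact hlf.isClosed_iUnion fun C => hclosed C C.2

end Topology

section Action

variable {G H Y : Type*} [Group G] [MulAction G Y]

theorem sUnion_smul_mem {𝒞 : Set (Set Y)} (hinv : ∀ g : G, ∀ C ∈ 𝒞, g • C ∈ 𝒞) (g : G) :
    ∀ z ∈ ⋃₀ 𝒞, g • z ∈ ⋃₀ 𝒞 := by
  rintro z ⟨C, hC, hz⟩
  exact ⟨g • C, hinv g C hC, smul_mem_smul_set hz⟩

theorem preimage_image_mk_eq_self {s : Set Y} (hs : ∀ g : G, ∀ z ∈ s, g • z ∈ s) :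
    Quotient.mk (orbitRel G Y) ⁻¹' (Quotient.mk (orbitRel G Y) '' s) = s := by
  refine Subset.antisymm ?_ (subset_preimage_image _ _)
  rintro z ⟨w, hw, hwz⟩
  obtain ⟨g, rfl⟩ := Quotient.exact hwz.symm
  exact hs g w hw

theorem image_mk_sUnion_orbit (C : Set Y) :
    Quotient.mk (orbitRel G Y) '' ⋃₀ orbit G C = Quotient.mk (orbitRel G Y) '' C := by
  refine Subset.antisymm ?_ (image_mono (subset_sUnion_of_mem (mem_orbit_self C)))
  rintro _ ⟨_, ⟨_, ⟨g, rfl⟩, w, hw, rfl⟩, rfl⟩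
  exact ⟨w, hw, Quotient.sound ((orbitRel G Y).symm ⟨g, rfl⟩)⟩

variable [TopologicalSpace Y]

theorem isClosed_image_mk [ContinuousConstSMul G Y] {s : Set Y} (hs : IsClosed s)
    (hinv : ∀ g : G, ∀ z ∈ s, g • z ∈ s) : IsClosed (Quotient.mk (orbitRel G Y) '' s) := by
  rwa [← isOpenQuotientMap_quotientMk.isQuotientMap.isClosed_preimage,
    preimage_image_mk_eq_self hinv]

theorem isCancelSMul_of_torsionFree [ProperlyDiscontinuousSMul G Y]
    (htf : ∀ g : G, IsOfFinOrder g → g = 1) : IsCancelSMul G Y := by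
  refine isCancelSMul_iff_eq_one_of_smul_eq.2 fun g z hz => htf g ?_
  refine finite_powers.1 ((ProperlyDiscontinuousSMul.finite_stabilizer z).subset ?_)
  exact Submonoid.powers_le (P := (stabilizer G z).toSubmonoid).2 hz

theorem properSMul_of_isOpenQuotientMap [TopologicalSpace G] [TopologicalSpace H] [Group H]
    [MulAction H Y] [ProperSMul G Y] {f : G → H} (hf : IsOpenQuotientMap f)
    (hsmul : ∀ (g : G) (y : Y), f g • y = g • y) : ProperSMul H Y := by
  have hq : IsOpenQuotientMap (Prod.map f (id : Y → Y)) := hf.prodMap .id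
  have hcomp : (fun p : H × Y => (p.1 • p.2, p.2)) ∘ Prod.map f id =
      fun p : G × Y => (p.1 • p.2, p.2) := by
    ext p <;> simp [hsmul]
  have hproper := hcomp ▸ ProperSMul.isProperMap_smul_pair (G := G) (X := Y)
  exact ⟨isProperMap_of_comp_of_surj hq.continuous
    (hq.isQuotientMap.continuous_iff.2 hproper.continuous) hproper hq.surjective⟩

end Action

section InvariantFamily

variable {G Y : Type*} [Group G] [MulAction G Y] [TopologicalSpace Y] [ContinuousConstSMul G Y]
  {𝒞 : Set (Set Y)} {C : Set Y}

theorem connectedComponentIn_image_mk_sUnion (hinv : ∀ g : G, ∀ C ∈ 𝒞, g • C ∈ 𝒞)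
    (hlf : LocallyFinite ((↑) : 𝒞 → Set Y)) (hclosed : ∀ C ∈ 𝒞, IsClosed C)
    (hdisj : 𝒞.PairwiseDisjoint id) (hC : C ∈ 𝒞) (hconn : IsPreconnected C) {z : Y} (hz : z ∈ C) :
    connectedComponentIn (Quotient.mk (orbitRel G Y) '' ⋃₀ 𝒞) (Quotient.mk _ z) =
      Quotient.mk _ '' C := by
  have horbit : orbit G C ⊆ 𝒞 := by
    rintro _ ⟨g, rfl⟩
    exact hinv g C hC
  have hinv_orbit : ∀ g : G, ∀ D ∈ orbit G C, g • D ∈ orbit G C := fun g D hD =>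
    mem_orbit_of_mem_orbit g hD
  have hinv_rest : ∀ g : G, ∀ D ∈ 𝒞 \ orbit G C, g • D ∈ 𝒞 \ orbit G C := fun g D hD =>
    ⟨hinv g D hD.1, fun h => hD.2 (inv_smul_smul g D ▸ hinv_orbit g⁻¹ _ h)⟩
  have hclosed_image : ∀ 𝒟 ⊆ 𝒞, (∀ g : G, ∀ D ∈ 𝒟, g • D ∈ 𝒟) →
      IsClosed (Quotient.mk (orbitRel G Y) '' ⋃₀ 𝒟) := fun 𝒟 h𝒟 hinv𝒟 =>
    isClosed_image_mk
      (isClosed_sUnion_of_locallyFinite (hlf.comp_injective (inclusion_injective h𝒟))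
        fun D hD => hclosed D (h𝒟 hD))
      (sUnion_smul_mem hinv𝒟)
  have hdisj_image : Disjoint (Quotient.mk (orbitRel G Y) '' ⋃₀ orbit G C)
      (Quotient.mk (orbitRel G Y) '' ⋃₀ (𝒞 \ orbit G C)) := by
    rw [disjoint_image_right, preimage_image_mk_eq_self (sUnion_smul_mem hinv_orbit)]
    simp only [disjoint_sUnion_left, disjoint_sUnion_right]
    exact fun E hE D hD => hdisj (horbit hD) hE.1 fun h => hE.2 (h ▸ hD)
  rw [← union_sdiff_cancel horbit, sUnion_union, image_union, ← image_mk_sUnion_orbit C]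
  refine connectedComponentIn_union_eq_left (hclosed_image _ horbit hinv_orbit)
    (hclosed_image _ sdiff_subset hinv_rest) hdisj_image ?_ ?_
  · rw [image_mk_sUnion_orbit]
    exact hconn.image _ isOpenQuotientMap_quotientMk.continuous.continuousOn
  · exact ⟨z, ⟨C, mem_orbit_self C, hz⟩, rfl⟩

variable [WeaklyLocallyCompactSpace Y] [CompactSpace (orbitRel.Quotient G Y)]

variable (G Y) in
theorem exists_isCompact_forall_exists_smul_mem :
    ∃ K : Set Y, IsCompact K ∧ ∀ z, ∃ g : G, g • z ∈ K := by
  obtain ⟨K, hK, hcover⟩ :=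
    exists_isCompact_image_eq_univ (isOpenQuotientMap_quotientMk (Γ := G) (T := Y))
  refine ⟨K, hK, fun z => ?_⟩
  obtain ⟨w, hw, hwz⟩ := hcover.ge (mem_univ (Quotient.mk _ z))
  obtain ⟨g, rfl⟩ := Quotient.exact hwz
  exact ⟨g, hw⟩

theorem exists_isCompact_forall_exists_mem_stabilizer_smul_mem
    (hinv : ∀ g : G, ∀ C ∈ 𝒞, g • C ∈ 𝒞) (hlf : LocallyFinite ((↑) : 𝒞 → Set Y)) (hC : C ∈ 𝒞) :
    ∃ K : Set Y, IsCompact K ∧ ∀ z ∈ C, ∃ g ∈ stabilizer G C, g • z ∈ K := by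
  obtain ⟨K, hK, hcover⟩ := exists_isCompact_forall_exists_smul_mem G Y
  -- The translates of `C` that meet `K`; each is carried back to `C` by one fixed element of `G`.
  let T : Set 𝒞 := {D | (↑D ∩ K).Nonempty ∧ ↑D ∈ orbit G C}
  have : Finite T := (hlf.finite_nonempty_inter_compact hK).subset fun _ hD => hD.1
  choose k hk using fun D : T => D.2.2
  refine ⟨⋃ D : T, (k D)⁻¹ • K, isCompact_iUnion fun D => hK.smul _, fun z hz => ?_⟩
  obtain ⟨g, hg⟩ := hcover z
  let D : T := ⟨⟨g • C, hinv g C hC⟩, ⟨g • z, smul_mem_smul_set hz, hg⟩, g, rfl⟩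
  have hkD : k D • C = g • C := hk D
  refine ⟨(k D)⁻¹ * g, ?_, mem_iUnion.2 ⟨D, ?_⟩⟩
  · rw [mem_stabilizer_iff, mul_smul, ← hkD, inv_smul_smul]
  · rw [mul_smul]
    exact smul_mem_smul_set hg

end InvariantFamily

section Geodesic

variable {G Y : Type*} [Group G] [MetricSpace Y] [MulAction G Y] [IsIsometricSMul G Y]
  {c : ℝ → Y}

theorem eq_add_of_isometry_of_forall_ne {f : ℝ → ℝ} (hf : Isometry f) (hfix : ∀ t, f t ≠ t)
    (t : ℝ) : f t = t + f 0 := by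
  have hpm : ∀ s t, f s - f t = s - t ∨ f s - f t = -(s - t) := fun s t =>
    abs_eq_abs.1 (hf.dist_eq s t)
  -- A reflection would fix the midpoint of `0` and `f 0`.
  have hmid : f (f 0 / 2) = f 0 / 2 + f 0 := by
    rcases hpm (f 0 / 2) 0 with h | h
    · linarith
    · exact absurd (by linarith) (hfix (f 0 / 2))
  rcases hpm t 0 with h | h
  · linarith
  · rcases hpm t (f 0 / 2) with h' | h'
    · linarith
    · exact absurd (by linarith) (hfix 0)

theorem exists_forall_smul_eq_add (hc : Isometry c) {g : G} (hg : g • range c = range c)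
    (hfix : ∀ z : Y, g • z ≠ z) : ∃ a ≠ 0, ∀ t, g • c t = c (t + a) := by
  have hmem : ∀ t, g • c t ∈ range c := fun t => hg ▸ smul_mem_smul_set (mem_range_self t)
  choose f hf using hmem
  have hf_isometry : Isometry f := Isometry.of_dist_eq fun s t => by
    rw [← hc.dist_eq, hf, hf, dist_smul, hc.dist_eq]
  have hf_ne : ∀ t, f t ≠ t := fun t ht => hfix (c t) (by rw [← hf, ht])
  refine ⟨f 0, hf_ne 0, fun t => ?_⟩
  rw [← hf, eq_add_of_isometry_of_forall_ne hf_isometry hf_ne]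

theorem exists_pos_forall_smul_eq_add [IsCancelSMul G Y] [WeaklyLocallyCompactSpace Y]
    [CompactSpace (orbitRel.Quotient G Y)] {𝒞 : Set (Set Y)}
    (hinv : ∀ g : G, ∀ C ∈ 𝒞, g • C ∈ 𝒞) (hlf : LocallyFinite ((↑) : 𝒞 → Set Y))
    (hc : Isometry c) (hmem : range c ∈ 𝒞) : ∃ L > 0, ∃ g : G, ∀ t, g • c t = c (t + L) := by
  obtain ⟨K, hK, hcover⟩ := exists_isCompact_forall_exists_mem_stabilizer_smul_mem hinv hlf hmem
  obtain ⟨g, hg, hg1⟩ : ∃ g ∈ stabilizer G (range c), g ≠ 1 := by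
    by_contra! htrivial
    have hcK : c ⁻¹' K = univ := eq_univ_of_forall fun t => by
      obtain ⟨g, hg, hgt⟩ := hcover (c t) (mem_range_self t)
      rwa [htrivial g hg, one_smul] at hgt
    exact noncompact_univ ℝ (hcK ▸ hc.isClosedEmbedding.isCompact_preimage hK)
  obtain ⟨a, ha, hga⟩ := exists_forall_smul_eq_add hc hg fun z hz =>
    hg1 (IsCancelSMul.eq_one_of_smul hz)
  rcases ha.lt_or_gt with ha | ha
  · refine ⟨-a, neg_pos.2 ha, g⁻¹, fun t => ?_⟩
    rw [inv_smul_eq_iff, hga, neg_add_cancel_right]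
  · exact ⟨a, ha, g, hga⟩

end Geodesic

namespace HypSurface

instance : IsIsometricSMul PSL(2, ℝ) ℍ where
  isometry_smul g := by
    induction g using QuotientGroup.induction_on with
    | H a => exact isometry_smul ℍ a

instance (Γ : Subgroup PSL(2, ℝ)) : IsIsometricSMul Γ ℍ where
  isometry_smul g := isometry_smul ℍ (g : PSL(2, ℝ))

instance : ProperSMul PSL(2, ℝ) ℍ :=
  properSMul_of_isOpenQuotientMap QuotientGroup.isOpenQuotientMap_mk
    fun (_ : SL(2, ℝ)) _ => rfl

instance : IsClosed (Subgroup.center SL(2, ℝ) : Set SL(2, ℝ)) := by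
  rw [Subgroup.coe_center, ← centralizer_univ]
  exact isClosed_centralizer _

instance (Γ : Subgroup PSL(2, ℝ)) [DiscreteTopology Γ] : ProperlyDiscontinuousSMul Γ ℍ := by
  have : IsClosed (Γ : Set PSL(2, ℝ)) := Subgroup.isClosed_of_discrete
  rw [properlyDiscontinuousSMul_iff_properSMul]
  infer_instance

theorem sigma_re (z : ℍ) : (sigma z).re = -z.re := by
  change (-conj (z : ℂ)).re = _
  simp

theorem sigma_im (z : ℍ) : (sigma z).im = z.im := by
  change (-conj (z : ℂ)).im = _
  simp

theorem isometry_sigma : Isometry sigma := by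
  refine Isometry.of_dist_eq fun z w => ?_
  have hdist : dist (sigma z : ℂ) (sigma w) = dist (z : ℂ) w := by
    change dist (-conj (z : ℂ)) (-conj (w : ℂ)) = _
    rw [dist_neg_neg, Complex.dist_conj_conj]
  rw [UpperHalfPlane.dist_eq, UpperHalfPlane.dist_eq, hdist, sigma_im, sigma_im]

theorem sigma_smul (g : PSL(2, ℝ)) (z : ℍ) : sigma (g • z) = hat g • sigma z := by
  rw [hat_smul, sigma_sigma]

/-- The fixed point set of the orientation reversing isometry `σ g`, written without inverting `σ`:
it is either empty or a complete geodesic. -/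
def mirror (g : PSL(2, ℝ)) : Set ℍ := {z | g • z = sigma z}

theorem mem_mirror_iff {g : PSL(2, ℝ)} {z : ℍ} : z ∈ mirror g ↔ g • z = sigma z := Iff.rfl

theorem isClosed_mirror (g : PSL(2, ℝ)) : IsClosed (mirror g) :=
  isClosed_eq (continuous_const_smul g) isometry_sigma.continuous

theorem smul_mirror (k g : PSL(2, ℝ)) : k • mirror g = mirror (hat k * g * k⁻¹) := by
  ext z
  rw [mem_smul_set_iff_inv_smul_mem, mem_mirror_iff, mem_mirror_iff, sigma_smul, map_inv,
    eq_inv_smul_iff, mul_smul, mul_smul]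

theorem mirror_one : mirror 1 = {z : ℍ | z.re = 0} := by
  ext z
  rw [mem_mirror_iff, one_smul]
  refine ⟨fun h => ?_, fun h => UpperHalfPlane.ext_re_im ?_ (sigma_im z).symm⟩
  · exact self_eq_neg.1 ((congrArg UpperHalfPlane.re h).trans (sigma_re z))
  · exact (self_eq_neg.2 h).trans (sigma_re z).symm

theorem range_vertical_line (a : ℝ) :
    range (fun t => UpperHalfPlane.mk ⟨a, Real.exp t⟩ (Real.exp_pos t)) = {z : ℍ | z.re = a} := by
  ext z
  constructor
  · rintro ⟨t, rfl⟩
    rfl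
  · rintro rfl
    exact ⟨Real.log z.im, UpperHalfPlane.ext (Complex.ext rfl (Real.exp_log z.im_pos))⟩

theorem diag_eq_of_smul_eq_sigma {a : SL(2, ℝ)} {z : ℍ} (h : a • z = sigma z) :
    a 0 0 = a 1 1 := by
  have hdenom : ((a 1 0 : ℝ) : ℂ) * z + (a 1 1 : ℝ) ≠ 0 := UpperHalfPlane.denom_ne_zero a z
  have heq : (a 0 0 : ℂ) * z + a 0 1 = -conj (z : ℂ) * (a 1 0 * z + a 1 1) := by
    rw [UpperHalfPlane.ext_iff, UpperHalfPlane.coe_specialLinearGroup_apply] at h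
    exact (div_eq_iff hdenom).1 h
  have him : a 0 0 * z.im = a 1 1 * z.im := by
    have := congrArg Complex.im heq
    simp only [Complex.add_im, Complex.mul_im, Complex.neg_im, Complex.conj_im, Complex.ofReal_re,
      Complex.ofReal_im, Complex.add_re, Complex.mul_re, Complex.neg_re, Complex.conj_re,
      UpperHalfPlane.coe_re, UpperHalfPlane.coe_im] at this
    linarith
  exact mul_right_cancel₀ z.im_pos.ne' him

theorem exists_hatSL_mul_eq {a : SL(2, ℝ)} (hdiag : a 0 0 = a 1 1) (h : a 0 0 ≠ -1) :
    ∃ k, hatSL k * a = k := by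
  have hdet := a.det_coe
  rw [Matrix.det_fin_two, ← hdiag] at hdet
  have hne : a 0 0 + 1 ≠ 0 := fun h0 => h (by linarith)
  obtain ⟨k, hk⟩ : ∃ k : SL(2, ℝ), (k : Matrix (Fin 2) (Fin 2) ℝ) =
      !![(a 0 0 + 1) / 2, a 0 1 / 2; a 1 0 / (a 0 0 + 1), 1] := by
    refine ⟨⟨_, ?_⟩, rfl⟩
    rw [Matrix.det_fin_two_of]
    field_simp
    linear_combination hdet
  refine ⟨k, Subtype.ext ?_⟩
  rw [Matrix.SpecialLinearGroup.coe_mul, hatSL_coe, hk, Matrix.eta_fin_two (a : Matrix _ _ ℝ),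
    ← hdiag]
  ext i j
  fin_cases i <;> fin_cases j <;>
    simp only [Fin.zero_eta, Fin.mk_one, Matrix.mul_apply, Fin.sum_univ_two, Matrix.of_apply,
      Matrix.cons_val', Matrix.cons_val_zero, Matrix.cons_val_one, Matrix.cons_val_fin_one] <;>
    field_simp <;> linarith

theorem exists_hat_mul_mul_inv_eq_one {g : PSL(2, ℝ)} (hg : (mirror g).Nonempty) :
    ∃ k, hat k * g * k⁻¹ = 1 := by
  suffices ∃ a : SL(2, ℝ), (a : PSL(2, ℝ)) = g ∧ a 0 0 = a 1 1 ∧ a 0 0 ≠ -1 by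
    obtain ⟨a, rfl, hdiag, hne⟩ := this
    obtain ⟨k, hk⟩ := exists_hatSL_mul_eq hdiag hne
    exact ⟨k, mul_inv_eq_one.2 (congrArg (QuotientGroup.mk (s := Subgroup.center SL(2, ℝ))) hk)⟩
  obtain ⟨z, hz⟩ := hg
  induction g using QuotientGroup.induction_on with
  | H a =>
    have hdiag : a 0 0 = a 1 1 := diag_eq_of_smul_eq_sigma hz
    by_cases hne : a 0 0 = -1
    · refine ⟨-a, QuotientGroup.eq.2 (Subgroup.mem_center_iff.2 fun b => ?_), by simp [hdiag],
        by norm_num [hne]⟩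
      simp
    · exact ⟨a, rfl, hdiag, hne⟩

theorem exists_isometry_range_eq_mirror {g : PSL(2, ℝ)} (hg : (mirror g).Nonempty) :
    ∃ c : ℝ → ℍ, Isometry c ∧ range c = mirror g := by
  obtain ⟨k, hk⟩ := exists_hat_mul_mul_inv_eq_one hg
  refine ⟨_, (isometry_smul ℍ k⁻¹).comp (UpperHalfPlane.isometry_vertical_line 0), ?_⟩
  rw [range_comp, range_vertical_line, ← mirror_one, ← hk, ← smul_mirror, image_smul,
    inv_smul_smul]

/-- The family of all mirrors of `σ Γ`. It may contain the empty set. -/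
def mirrors (Γ : Subgroup PSL(2, ℝ)) : Set (Set ℍ) := range fun g : Γ => mirror g

variable (Γ : Subgroup PSL(2, ℝ))

theorem fixedPoints_sigmaStar (hΓ : Γ.map hat = Γ) :
    Function.fixedPoints (sigmaStar Γ hΓ) = proj Γ '' ⋃₀ mirrors Γ := by
  have hmem : ∀ z, proj Γ z ∈ Function.fixedPoints (sigmaStar Γ hΓ) ↔ z ∈ ⋃₀ mirrors Γ := by
    intro z
    rw [mirrors, sUnion_range, mem_iUnion]
    exact Quotient.eq (x := sigma z) (y := z)
  ext x
  constructor
  · obtain ⟨z, rfl⟩ := Quotient.exists_rep x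
    exact fun hz => ⟨z, (hmem z).1 hz, rfl⟩
  · rintro ⟨z, hz, rfl⟩
    exact (hmem z).2 hz

theorem isClosed_of_mem_mirrors : ∀ C ∈ mirrors Γ, IsClosed C := by
  rintro _ ⟨g, rfl⟩
  exact isClosed_mirror _

theorem smul_mem_mirrors (hΓ : Γ.map hat = Γ) (k : Γ) : ∀ C ∈ mirrors Γ, k • C ∈ mirrors Γ := by
  rintro _ ⟨g, rfl⟩
  have hk : hat k ∈ Γ := hΓ.le (Subgroup.mem_map_of_mem hat k.2)
  exact ⟨⟨hat k, hk⟩ * g * k⁻¹, (smul_mirror k g).symm⟩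

theorem locallyFinite_mirrors [ProperlyDiscontinuousSMul Γ ℍ] :
    LocallyFinite ((↑) : mirrors Γ → Set ℍ) := by
  refine LocallyFinite.on_range fun z => ?_
  obtain ⟨K, hK, hKz⟩ := exists_compact_mem_nhds z
  refine ⟨K, hKz, (ProperlyDiscontinuousSMul.finite_disjoint_inter_image hK
    (hK.image isometry_sigma.continuous)).subset ?_⟩
  rintro g ⟨w, hw, hwK⟩
  exact ⟨sigma w, ⟨w, hwK, hw⟩, w, hwK, rfl⟩

theorem pairwiseDisjoint_mirrors [IsCancelSMul Γ ℍ] : (mirrors Γ).PairwiseDisjoint id := by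
  rintro _ ⟨g, rfl⟩ _ ⟨h, rfl⟩ hne
  refine disjoint_left.2 fun z hzg hzh => hne ?_
  have hgh : g • z = h • z := (mem_mirror_iff.1 hzg).trans (mem_mirror_iff.1 hzh).symm
  rw [IsCancelSMul.right_cancel g h z hgh]

end HypSurface

theorem theorem2p2 (Γ : Subgroup PSL(2, ℝ))
    (hdiscrete : DiscreteTopology Γ)
    (hcocompact : CompactSpace (HypSurface.Surface Γ))
    (htorsionfree : ∀ γ ∈ Γ, IsOfFinOrder γ → γ = 1)
    (hsigma : Γ.map HypSurface.hat = Γ) :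
    ∀ x ∈ Function.fixedPoints (HypSurface.sigmaStar Γ hsigma),
      HypSurface.IsClosedGeodesic Γ
        (connectedComponentIn (Function.fixedPoints (HypSurface.sigmaStar Γ hsigma)) x) := by
  have hfree : IsCancelSMul Γ ℍ := isCancelSMul_of_torsionFree fun γ hγ =>
    Subtype.ext (htorsionfree γ γ.2 (Submonoid.isOfFinOrder_coe.2 hγ))
  have hinv := HypSurface.smul_mem_mirrors Γ hsigma
  have hlf := HypSurface.locallyFinite_mirrors Γ
  rw [HypSurface.fixedPoints_sigmaStar]
  rintro _ ⟨z, ⟨_, ⟨g, rfl⟩, hz⟩, rfl⟩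
  obtain ⟨c, hc, hrange⟩ := HypSurface.exists_isometry_range_eq_mirror ⟨z, hz⟩
  have hmem : range c ∈ HypSurface.mirrors Γ := ⟨g, hrange.symm⟩
  obtain ⟨L, hL, γ, hγ⟩ := exists_pos_forall_smul_eq_add hinv hlf hc hmem
  refine ⟨c, L, hc, hL, fun t => Quotient.sound ⟨γ, hγ t⟩, ?_⟩
  rw [range_comp' (HypSurface.proj Γ) c]
  exact connectedComponentIn_image_mk_sUnion hinv hlf (HypSurface.isClosed_of_mem_mirrors Γ)
    (HypSurface.pairwiseDisjoint_mirrors Γ) hmem (isPreconnected_range hc.continuous)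
    (hrange ▸ hz)
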